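/- **Setting.** Let $\mathbb F$ be an algebraically closed field, $N\ge 1$, $m\ge 0$ integers, $\sigma_0,\dots,\sigma_{N-1}\in\mathbb F$ (nodes), $\xi_1,\dots,\xi_N\in(\mathbb F\cup\{\infty\})\setminus\{0\}$ (poles), $\beta_0,\dots,\beta_N\in\mathbb F\setminus\{0\}$ and $D_0,\dots,D_N\in\mathbb F^{m\times m}$. Nodes and poles may coincide. Put $g_i(\lambda)=\beta_i(1-\lambda/\xi_i)$ (where $\lambda/\infty:=0$), $h_j(\lambda)=\lambda-\sigma_j$, $$b_i(\lambda)=\frac1{\beta_0}\prod_{k=1}^{i}\frac{h_{k-1}(\lambda)}{g_k(\lambda)}\quad(0\le i\le N),\qquad Q_N(\lambda)=\sum_{i=0}^N b_i(\lambda)D_i\in\mathbb F(\lambda)^{m\times m},$$ and $L_N(\lambda)=\begin{bmatrix}M_N(\lambda)\\K_N(\lambda)\end{bmatrix}$, where $$M_N=\Big[\tfrac{g_N}{\beta_N}D_0\ \ \cdots\ \ \tfrac{g_N}{\beta_N}D_{N-2}\ \ \tfrac{g_N}{\beta_N}D_{N-1}+\tfrac{h_{N-1}}{\beta_N}D_N\Big],$$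 and $K_N=B\otimes I_m$, $B$ being the $(N-1)\times N$ matrix whose $i$-th row ($0\le i\le N-2$) has $-h_i$ in column $i$, $g_{i+1}$ in column $i+1$ (columns numbered $0,\dots,N-1$) and zeros elsewhere; $K_N$ is empty if $N=1$. Let $\mathcal P_N$ be the set of finite poles and $i_N$ the number of infinite poles (with repetitions) in the list $(\xi_1,\dots,\xi_N)$. **Definitions.** A rational matrix $R$ is *defined at* $\lambda_0\in\mathbb F$ if no entry has a pole at $\lambda_0$; it has *full row rank in* $\Omega\subseteq\mathbb F$ if for all $\lambda_0\in\Omega$ it is defined at $\lambda_0$ and $R(\lambda_0)$ has full row rank. A square $R$ is *regular at* $\lambda_0$ if it is defined there and $\det R(\lambda_0)\ne0$. For $g\in\mathbb Z$, $\operatorname{rev}_gR(\lambda):=\lambda^gR(1/\lambda)$. A *pencil* is a polynomial matrix of degree at most $1$. *Block full rank pencil.* A pencil $L=\begin{bmatrix}M&K_2^T\\K_1&0\end{bmatrix}$ with $K_1,K_2$ (possibly empty) of full row rank over $\mathbb F(\lambda)$. It is *associated with* a rational matrix $G$ in a nonempty set $\Omega\subseteq\mathbb F$ if there are rational matrices $N_1,N_2$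 such that, for $i=1,2$, $N_i$ has full row rank over $\mathbb F(\lambda)$, $K_iN_i^T=0$, the numbers of rows of $K_i$ and $N_i$ add up to their common number of columns, $K_i$ and $N_i$ have full row rank in $\Omega$, and $G=N_2MN_1^T$. "Only one block column" means that $K_2$ is empty. *Linearizations.* A *linear polynomial system matrix* is a partitioned pencil $\mathcal L=\begin{bmatrix}A&B\\-C&D\end{bmatrix}$ with square *state matrix* $A$, of size $n\ge0$ and with $\det A\not\equiv0$; its transfer function is $\widehat G=D+CA^{-1}B$. It is *minimal at* $\lambda_0$ if $\operatorname{rank}\begin{bmatrix}A(\lambda_0)\\C(\lambda_0)\end{bmatrix}=\operatorname{rank}\begin{bmatrix}A(\lambda_0)&B(\lambda_0)\end{bmatrix}=n$. If $n=0$ (*empty state matrix*), minimality always holds and $\widehat G=\mathcal L$. For $G\in\mathbb F(\lambda)^{p\times m'}$ and $\widehat G\in\mathbb F(\lambda)^{q\times r}$: * $\mathcal L$ is a *linearization of $G$ at* $\lambda_0\in\mathbb F$ if it is minimal at $\lambda_0$ and there are integers $s_1,s_2\ge0$ with $s_1-s_2=q-p=r-m'$ and rational matrices $R_1,R_2$ regular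 at $\lambda_0$ with $R_1\operatorname{diag}(G,I_{s_1})R_2=\operatorname{diag}(\widehat G,I_{s_2})$; it is a *linearization in* a nonempty set $\Omega\subseteq\mathbb F$ if it is one at each point of $\Omega$. * Let $\ell=\deg\mathcal L$ (with $\ell=0$ for the zero matrix). $\mathcal L$ is a *linearization of $G$ at $\infty$ of grade $g\in\mathbb Z$* if the matrix $\operatorname{rev}_\ell\mathcal L$, with the same partition, is minimal at $0$ and there are integers $s_1,s_2\ge0$ with $s_1-s_2=q-p=r-m'$ and rational matrices $R_1,R_2$ regular at $0$ with $R_1\operatorname{diag}(\operatorname{rev}_gG,I_{s_1})R_2=\operatorname{diag}(\operatorname{rev}_\ell\widehat G,I_{s_2})$. **Theorem.** (a) $L_N$, partitioned as $\begin{bmatrix}M_N\\K_N\end{bmatrix}$ (so $M=M_N$, $K_1=K_N$, $K_2$ empty), is a block full rank pencil with only one block column associated with $Q_N$ in $\mathbb F\setminus\mathcal P_N$. (b) $L_N$ is a linearization with empty state matrix of $Q_N$ in $\mathbb F\setminus\mathcal P_N$. (c) If $N\ge2$, or if $N=1$ and $\deg L_1=1$, then $L_N$ is a linearization with empty state matrix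 of $Q_N$ at $\infty$ of grade $i_N$. -/

import Mathlib

open scoped Polynomial Kronecker

noncomputable section

namespace LocalLin

/-! ### Polynomial and rational matrices

Polynomial matrices have entries in `F[X]`, rational matrices have entries in `RatFunc F`.
Rows and columns are indexed by arbitrary finite types. -/

section Basic

variable {F : Type*} [Field F]
variable {ι κ : Type*} [Fintype ι] [Fintype κ]

/-- A polynomial matrix, seen as a rational matrix. -/
def toRat (P : Matrix ι κ F[X]) : Matrix ι κ (RatFunc F) :=
  P.map (algebraMap F[X] (RatFunc F))

/-- The value `P(a)` of a polynomial matrix. -/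
def evalPoly (a : F) (P : Matrix ι κ F[X]) : Matrix ι κ F :=
  P.map (Polynomial.eval a)

/-- The largest exponent of the variable occurring in a polynomial matrix
(`0` if the matrix is zero). -/
def degree (P : Matrix ι κ F[X]) : ℕ :=
  Finset.univ.sup fun i => Finset.univ.sup fun j => (P i j).natDegree

/-- A pencil, or linear polynomial matrix: all entries have degree at most one. -/
def IsPencil (P : Matrix ι κ F[X]) : Prop := degree P ≤ 1

/-- `rev_d P = X ^ d * P(1 / X)`, for a polynomial matrix of degree at most `d`. -/
def revPoly (d : ℕ) (P : Matrix ι κ F[X]) : Matrix ι κ F[X] :=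
  P.map (Polynomial.reflect d)

/-- The rational matrix `R` is defined at `a`: no entry has a pole at `a`. -/
def DefinedAt (R : Matrix ι κ (RatFunc F)) (a : F) : Prop :=
  ∀ i j, (R i j).denom.eval a ≠ 0

/-- The value `R(a)`, meaningful when `R` is defined at `a`. -/
def evalRat (a : F) (R : Matrix ι κ (RatFunc F)) : Matrix ι κ F :=
  R.map (RatFunc.eval (RingHom.id F) a)

/-- A square rational matrix is regular at `a` if it is defined at `a` and `det R(a) ≠ 0`. -/
def RegularAt [DecidableEq ι] (R : Matrix ι ι (RatFunc F)) (a : F) : Prop :=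
  DefinedAt R a ∧ (evalRat a R).det ≠ 0

/-- The `g`-reversal `rev_g G = X ^ g * G(1 / X)` of a rational matrix, `g` any integer.
(Substituting `1 / X` never makes a nonzero denominator vanish.) -/
def revRat (g : ℤ) (G : Matrix ι κ (RatFunc F)) : Matrix ι κ (RatFunc F) :=
  fun i j => RatFunc.X ^ g * RatFunc.eval RatFunc.C (RatFunc.X)⁻¹ (G i j)

/-- Full row normal rank: full row rank over the field of rational functions. -/
def FullRowNormalRank (R : Matrix ι κ (RatFunc F)) : Prop :=
  R.rank = Fintype.card ι

/-- Full row rank in `S`: for each `a ∈ S`, `R` is defined at `a` and `R(a)` has full row rank. -/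
def FullRowRankIn (R : Matrix ι κ (RatFunc F)) (S : Set F) : Prop :=
  ∀ a ∈ S, DefinedAt R a ∧ (evalRat a R).rank = Fintype.card ι

/-- `K` and `H` are dual rational bases: both have full row normal rank, the numbers of rows
add up to the common number of columns, and `K Hᵀ = 0`. -/
def DualBases {η : Type*} [Fintype η] (K : Matrix ι κ (RatFunc F)) (H : Matrix η κ (RatFunc F)) :
    Prop :=
  FullRowNormalRank K ∧ FullRowNormalRank H ∧
    Fintype.card ι + Fintype.card η = Fintype.card κ ∧ K * H.transpose = 0

end Basic

/-! ### Polynomial system matrices and local linearizations -/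

/-- The blocks of a partitioned polynomial matrix `[A, B; -C, D]`, with state matrix `A`. -/
structure SystemMatrix (F : Type*) [Field F] (ν ι κ : Type*) where
  A : Matrix ν ν F[X]
  B : Matrix ν κ F[X]
  C : Matrix ι ν F[X]
  D : Matrix ι κ F[X]

namespace SystemMatrix

variable {F : Type*} [Field F]
variable {ν ι κ : Type*}

/-- The whole matrix `[A, B; -C, D]`. -/
def toMatrix (P : SystemMatrix F ν ι κ) : Matrix (ν ⊕ ι) (ν ⊕ κ) F[X] :=
  Matrix.fromBlocks P.A P.B (-P.C) P.D

variable [Fintype ν] [DecidableEq ν] [Fintype ι] [Fintype κ]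

/-- `P` is a linear polynomial system matrix: the state matrix is nonsingular (no condition if it
is empty) and all entries have degree at most one. -/
def IsLinear (P : SystemMatrix F ν ι κ) : Prop :=
  P.A.det ≠ 0 ∧ IsPencil P.toMatrix

/-- The transfer function matrix `D + C A⁻¹ B`. -/
def transfer (P : SystemMatrix F ν ι κ) : Matrix ι κ (RatFunc F) :=
  toRat P.D + toRat P.C * (toRat P.A)⁻¹ * toRat P.B

/-- Minimality at `a`; automatic if the state matrix is empty. -/
def MinimalAt (P : SystemMatrix F ν ι κ) (a : F) : Prop :=
  (Matrix.fromRows (evalPoly a P.A) (evalPoly a P.C)).rank = Fintype.card ν ∧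
    (Matrix.fromCols (evalPoly a P.A) (evalPoly a P.B)).rank = Fintype.card ν

/-- The reversal of `P`: every block is reversed with respect to the degree of the whole matrix. -/
def rev (P : SystemMatrix F ν ι κ) : SystemMatrix F ν ι κ where
  A := revPoly (degree P.toMatrix) P.A
  B := revPoly (degree P.toMatrix) P.B
  C := revPoly (degree P.toMatrix) P.C
  D := revPoly (degree P.toMatrix) P.D

/-- A polynomial matrix, seen as a system matrix with empty state matrix. -/
def ofEmptyState (L : Matrix ι κ F[X]) : SystemMatrix F Empty ι κ where
  A := Matrix.of fun i _ => i.elim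
  B := Matrix.of fun i _ => i.elim
  C := Matrix.of fun _ j => j.elim
  D := L

end SystemMatrix

/-- `diag(G, I_s)`. -/
def diagId {F : Type*} [Field F] {ι κ : Type*} (G : Matrix ι κ (RatFunc F)) (s : ℕ) :
    Matrix (ι ⊕ Fin s) (κ ⊕ Fin s) (RatFunc F) :=
  Matrix.fromBlocks G 0 0 1

section Linearization

variable {F : Type*} [Field F]
variable {ν ι κ ι' κ' : Type*} [Fintype ν] [DecidableEq ν]
variable [Fintype ι] [DecidableEq ι] [Fintype κ] [DecidableEq κ] [Fintype ι'] [Fintype κ']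

/-- `R₁ diag(G, I_{s₁}) R₂ = diag(H, I_{s₂})` for some nonnegative integers `s₁`, `s₂` and some
rational matrices `R₁`, `R₂` regular at `a`. The bijections `e`, `f` identify the row and column
indices of both sides; they exist exactly when `s₁ - s₂ = q - p = r - m` for `G` of size `p × m`
and `H` of size `q × r`, and the choice of them is irrelevant since permutation matrices are
regular. -/
def EquivUpToIdentityAt (G : Matrix ι κ (RatFunc F)) (H : Matrix ι' κ' (RatFunc F)) (a : F) :
    Prop :=
  ∃ (s₁ s₂ : ℕ) (e : ι ⊕ Fin s₁ ≃ ι' ⊕ Fin s₂) (f : κ ⊕ Fin s₁ ≃ κ' ⊕ Fin s₂)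
    (R₁ : Matrix (ι ⊕ Fin s₁) (ι ⊕ Fin s₁) (RatFunc F))
    (R₂ : Matrix (κ ⊕ Fin s₁) (κ ⊕ Fin s₁) (RatFunc F)),
    RegularAt R₁ a ∧ RegularAt R₂ a ∧
      Matrix.reindex e f (R₁ * diagId G s₁ * R₂) = diagId H s₂

/-- `P` is a linearization of `G` at the point `a`. -/
def IsLinearizationAt (P : SystemMatrix F ν ι' κ') (G : Matrix ι κ (RatFunc F)) (a : F) : Prop :=
  P.IsLinear ∧ P.MinimalAt a ∧ EquivUpToIdentityAt G P.transfer a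

/-- `P` is a linearization of `G` in the nonempty set `S`. -/
def IsLinearizationIn (P : SystemMatrix F ν ι' κ') (G : Matrix ι κ (RatFunc F)) (S : Set F) :
    Prop :=
  S.Nonempty ∧ ∀ a ∈ S, IsLinearizationAt P G a

/-- `P` is a linearization of `G` at infinity of grade `g`. -/
def IsLinearizationAtInfinity (P : SystemMatrix F ν ι' κ') (G : Matrix ι κ (RatFunc F)) (g : ℤ) :
    Prop :=
  P.IsLinear ∧ P.rev.MinimalAt 0 ∧
    EquivUpToIdentityAt (revRat g G) (revRat (degree P.toMatrix : ℤ) P.transfer) 0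

end Linearization

/-! ### Block full rank pencils -/

section BlockFullRank

variable {F : Type*} [Field F]
variable {ρ α γ δ η₁ η₂ : Type*} [Fintype ρ] [Fintype α] [Fintype γ] [Fintype δ]
  [Fintype η₁] [Fintype η₂]

/-- The partitioned matrix `L = [M, K₂ᵀ; K₁, 0]` is a block full rank pencil. The blocks are
`M = L.toBlocks₁₁`, `K₁ = L.toBlocks₂₁` and `K₂ = L.toBlocks₁₂ᵀ`; `K₁` or `K₂` may be empty. -/
def IsBlockFullRankPencil (L : Matrix (ρ ⊕ α) (γ ⊕ δ) F[X]) : Prop :=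
  IsPencil L ∧ L.toBlocks₂₂ = 0 ∧
    FullRowNormalRank (toRat L.toBlocks₂₁) ∧
    FullRowNormalRank (toRat L.toBlocks₁₂.transpose)

/-- `L = [M, K₂ᵀ; K₁, 0]` is a block full rank pencil associated with `G` in the nonempty set `S`:
there are rational bases `N₁`, `N₂` dual to `K₁`, `K₂` such that all of `K₁`, `K₂`, `N₁`, `N₂` have
full row rank in `S` and `G = N₂ M N₁ᵀ`. -/
def IsBlockFullRankPencilAssociatedIn (L : Matrix (ρ ⊕ α) (γ ⊕ δ) F[X])
    (G : Matrix η₂ η₁ (RatFunc F)) (S : Set F) : Prop :=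
  IsBlockFullRankPencil L ∧ S.Nonempty ∧
    ∃ (N₁ : Matrix η₁ γ (RatFunc F)) (N₂ : Matrix η₂ ρ (RatFunc F)),
      DualBases (toRat L.toBlocks₂₁) N₁ ∧ DualBases (toRat L.toBlocks₁₂.transpose) N₂ ∧
      FullRowRankIn (toRat L.toBlocks₂₁) S ∧ FullRowRankIn (toRat L.toBlocks₁₂.transpose) S ∧
      FullRowRankIn N₁ S ∧ FullRowRankIn N₂ S ∧
      G = N₂ * toRat L.toBlocks₁₁ * N₁.transpose

/-- A matrix `[M; K]` with two block rows, seen as `[M, K₂ᵀ; K, 0]` with `K₂` empty, that is, as a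
matrix with only one block column. -/
def oneBlockColumn (L : Matrix (ρ ⊕ α) γ F[X]) : Matrix (ρ ⊕ α) (γ ⊕ Empty) F[X] :=
  Matrix.reindex (Equiv.refl _) (Equiv.sumEmpty γ Empty).symm L

end BlockFullRank

/-! ### NLEIGS rational matrices and pencils

The parameters are the nodes `σ 0, …, σ (N - 1)`, the poles `ξ 1, …, ξ N` in `F ∪ {∞}`, the scaling
parameters `β 0, …, β N` and the coefficients `D 0, …, D N`; no other values are used. -/

section NLEIGS

variable {F : Type*} [Field F]

/-- The linear function `1 - X / ξ`, which is `1` if `ξ = ∞`. -/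
def poleFactor : OnePoint F → F[X]
  | OnePoint.infty => 1
  | OnePoint.some x => 1 - Polynomial.C x⁻¹ * Polynomial.X

/-- `g i = β i * (1 - X / ξ i)`. -/
def gFun (β : ℕ → F) (ξ : ℕ → OnePoint F) (i : ℕ) : F[X] :=
  Polynomial.C (β i) * poleFactor (ξ i)

/-- `h j = X - σ j`. -/
def hFun (σ : ℕ → F) (j : ℕ) : F[X] :=
  Polynomial.X - Polynomial.C (σ j)

/-- `b i = (1 / β 0) * ∏ k = 1, …, i, (X - σ (k - 1)) / (β k * (1 - X / ξ k))`. -/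
def bFun (σ β : ℕ → F) (ξ : ℕ → OnePoint F) (i : ℕ) : RatFunc F :=
  1 / RatFunc.C (β 0) * ∏ k ∈ Finset.Icc 1 i,
    algebraMap F[X] (RatFunc F) (hFun σ (k - 1)) / algebraMap F[X] (RatFunc F) (gFun β ξ k)

/-- `Q_N = b 0 * D 0 + … + b N * D N`. -/
def QMat {m : ℕ} (N : ℕ) (σ β : ℕ → F) (ξ : ℕ → OnePoint F) (D : ℕ → Matrix (Fin m) (Fin m) F) :
    Matrix (Fin m) (Fin m) (RatFunc F) :=
  ∑ i ∈ Finset.range (N + 1), bFun σ β ξ i • (D i).map RatFunc.C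

/-- `M_N`: the block in block column `j` is `(g N / β N) D j`, with the extra summand
`(h (N - 1) / β N) D N` in the last block column. -/
def MMat {m : ℕ} (N : ℕ) (σ β : ℕ → F) (ξ : ℕ → OnePoint F) (D : ℕ → Matrix (Fin m) (Fin m) F) :
    Matrix (Fin m) (Fin N × Fin m) F[X] :=
  fun a jb =>
    Polynomial.C (β N)⁻¹ * gFun β ξ N * Polynomial.C (D jb.1 a jb.2) +
      if (jb.1 : ℕ) = N - 1 then
        Polynomial.C (β N)⁻¹ * hFun σ (N - 1) * Polynomial.C (D N a jb.2)
      else 0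

/-- The `(N - 1) × N` bidiagonal matrix with rows `(0, …, 0, -h i, g (i + 1), 0, …, 0)`. -/
def bidiagonal (N : ℕ) (σ β : ℕ → F) (ξ : ℕ → OnePoint F) : Matrix (Fin (N - 1)) (Fin N) F[X] :=
  fun i j =>
    if (j : ℕ) = i then -hFun σ i
    else if (j : ℕ) = i + 1 then gFun β ξ (i + 1)
    else 0

/-- `K_N`, the Kronecker product of the bidiagonal matrix with `I_m`. -/
def KMat (N m : ℕ) (σ β : ℕ → F) (ξ : ℕ → OnePoint F) :
    Matrix (Fin (N - 1) × Fin m) (Fin N × Fin m) F[X] :=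
  bidiagonal N σ β ξ ⊗ₖ (1 : Matrix (Fin m) (Fin m) F[X])

/-- The NLEIGS pencil `L_N = [M_N; K_N]`. -/
def LMat {m : ℕ} (N : ℕ) (σ β : ℕ → F) (ξ : ℕ → OnePoint F) (D : ℕ → Matrix (Fin m) (Fin m) F) :
    Matrix (Fin m ⊕ Fin (N - 1) × Fin m) (Fin N × Fin m) F[X] :=
  Matrix.fromRows (MMat N σ β ξ D) (KMat N m σ β ξ)

/-- The set of finite poles in the list `ξ 1, …, ξ N`. -/
def finitePoles (N : ℕ) (ξ : ℕ → OnePoint F) : Set F :=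
  {x | ∃ k, 1 ≤ k ∧ k ≤ N ∧ ξ k = (x : OnePoint F)}

open Classical in
/-- The number of infinite poles in the list `ξ 1, …, ξ N`, counted with repetitions. -/
def numInfinitePoles (N : ℕ) (ξ : ℕ → OnePoint F) : ℕ :=
  ((Finset.Icc 1 N).filter fun k => ξ k = OnePoint.infty).card

end NLEIGS

end LocalLin

end

/-!
The functions `b 0, …, b N` satisfy the two-term recurrence `b (i + 1) g (i + 1) = b i h i`, which
says exactly that the column `(b 0, …, b (N - 1))` spans the kernel of the bidiagonal matrix `B`;
multiplying it by the top block row `M` gives `(g N / β N) Q` (`sum_bidiagonalOf_mul`,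
`toRat_topRowOf_mul_blockColumn`).

Fix a pivot column `p` and let `r j = b j / b p` and `d = (g N / β N) / b p`, so that
`M (r ⊗ I) = d Q`. With `M'` and `B'` denoting `M` and `B` without the (block) column `p`, and `r'`
denoting `r ⊗ I` without its block row `p`, moving the block column `p` to the front turns the
pencil `[M; B ⊗ I]` into

  `[I, M'; 0, B' ⊗ I] * diag(Q, I) * [d I, 0; -r', I]`.

The outer factors are regular at every point where `det B'` does not vanish, `d` is a unit and the
`r j` have no poles (`equivUpToIdentityAt_of_kernel`). The matrix `d⁻¹ (r ⊗ I)ᵀ` is then also the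
dual basis needed for a block full rank pencil (`isBlockFullRankPencilAssociatedIn_of_kernel`).

* At a finite point which is not a pole, take `p = 0`: the matrix `B'` is lower triangular with
  diagonal entries `g 1, …, g (N - 1)`, none of which vanishes there.
* At infinity, the reversed pencil has the same shape, with `g` and `h` replaced by their reversals
  and `b i` by `X ^ i_N * b i (1 / X)`. Some reversed `g k` may vanish at `0`, but the reversed
  `h k` take the value `1`, so take `p = N - 1`: the matrix `B'` is upper triangular with diagonal
  entries `-h k`. Each infinite pole contributes a simple zero of the reversed `g k`, which the
  factor `X ^ i_N` cancels, so `d` is a unit (`unitFunAt_zero_pow_mul_invSubst_bFun`).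
-/

noncomputable section

namespace LocalLin

/-! ### The local ring of rational functions at a point -/

section Local

variable {F : Type*} [Field F]

/-- The rational function `f` lies in the local ring of rational functions defined at `a`. It is
witnessed by any fraction, not necessarily reduced, whose denominator does not vanish at `a`. -/
def RegularFunAt (a : F) (f : RatFunc F) : Prop :=
  ∃ p q : F[X], q.eval a ≠ 0 ∧ f = algebraMap F[X] (RatFunc F) p / algebraMap F[X] (RatFunc F) q

/-- The rational function `f` is a unit of the local ring at `a`: it has neither a zero nor a pole
at `a`. -/
def UnitFunAt (a : F) (f : RatFunc F) : Prop :=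
  ∃ p q : F[X], p.eval a ≠ 0 ∧ q.eval a ≠ 0 ∧
    f = algebraMap F[X] (RatFunc F) p / algebraMap F[X] (RatFunc F) q

variable {a : F} {f g : RatFunc F}

theorem UnitFunAt.regularFunAt (hf : UnitFunAt a f) : RegularFunAt a f := by
  obtain ⟨p, q, -, hq, rfl⟩ := hf
  exact ⟨p, q, hq, rfl⟩

theorem RegularFunAt.mul (hf : RegularFunAt a f) (hg : RegularFunAt a g) :
    RegularFunAt a (f * g) := by
  obtain ⟨p, q, hq, rfl⟩ := hf
  obtain ⟨p', q', hq', rfl⟩ := hg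
  exact ⟨p * p', q * q', by simp [hq, hq'], by simp [div_mul_div_comm]⟩

theorem RegularFunAt.neg (hf : RegularFunAt a f) : RegularFunAt a (-f) := by
  obtain ⟨p, q, hq, rfl⟩ := hf
  exact ⟨-p, q, hq, by simp [neg_div]⟩

theorem UnitFunAt.mul (hf : UnitFunAt a f) (hg : UnitFunAt a g) : UnitFunAt a (f * g) := by
  obtain ⟨p, q, hp, hq, rfl⟩ := hf
  obtain ⟨p', q', hp', hq', rfl⟩ := hg
  exact ⟨p * p', q * q', by simp [hp, hp'], by simp [hq, hq'], by simp [div_mul_div_comm]⟩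

theorem UnitFunAt.inv (hf : UnitFunAt a f) : UnitFunAt a f⁻¹ := by
  obtain ⟨p, q, hp, hq, rfl⟩ := hf
  exact ⟨q, p, hq, hp, by simp⟩

theorem UnitFunAt.div (hf : UnitFunAt a f) (hg : UnitFunAt a g) : UnitFunAt a (f / g) := by
  rw [div_eq_mul_inv]
  exact hf.mul hg.inv

theorem regularFunAt_algebraMap (p : F[X]) :
    RegularFunAt a (algebraMap F[X] (RatFunc F) p) :=
  ⟨p, 1, by simp, by simp⟩

theorem unitFunAt_algebraMap {p : F[X]} (hp : p.eval a ≠ 0) :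
    UnitFunAt a (algebraMap F[X] (RatFunc F) p) :=
  ⟨p, 1, hp, by simp, by simp⟩

theorem unitFunAt_C {c : F} (hc : c ≠ 0) : UnitFunAt a (RatFunc.C c) :=
  ⟨Polynomial.C c, 1, by simpa, by simp, by simp⟩

theorem RegularFunAt.denom_ne_zero (hf : RegularFunAt a f) : f.denom.eval a ≠ 0 := by
  obtain ⟨p, q, hq, rfl⟩ := hf
  intro h
  exact hq (Polynomial.eval_eq_zero_of_dvd_of_eval_eq_zero (RatFunc.denom_div_dvd p q) h)

theorem RegularFunAt.eval_mul (hf : RegularFunAt a f) (hg : RegularFunAt a g) :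
    RatFunc.eval (RingHom.id F) a (f * g) =
      RatFunc.eval (RingHom.id F) a f * RatFunc.eval (RingHom.id F) a g :=
  RatFunc.eval_mul _ _ hf.denom_ne_zero hg.denom_ne_zero

theorem UnitFunAt.ne_zero (hf : UnitFunAt a f) : f ≠ 0 := by
  obtain ⟨p, q, hp, hq, rfl⟩ := hf
  have hp0 : p ≠ 0 := by rintro rfl; simp at hp
  have hq0 : q ≠ 0 := by rintro rfl; simp at hq
  exact div_ne_zero (RatFunc.algebraMap_ne_zero hp0) (RatFunc.algebraMap_ne_zero hq0)

theorem UnitFunAt.eval_ne_zero (hf : UnitFunAt a f) : RatFunc.eval (RingHom.id F) a f ≠ 0 := by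
  intro h
  have := hf.regularFunAt.eval_mul hf.inv.regularFunAt
  rw [mul_inv_cancel₀ hf.ne_zero, h] at this
  simp at this

end Local

/-! ### The substitution `X ↦ 1 / X` -/

section Reversal

variable {F : Type*} [Field F]

/-- The denominator of a rational function does not vanish at `1 / X`, which is transcendental. -/
theorem eval₂_X_inv_ne_zero {q : F[X]} (hq : q ≠ 0) :
    q.eval₂ RatFunc.C (RatFunc.X : RatFunc F)⁻¹ ≠ 0 := by
  intro h
  refine RatFunc.transcendental_X (K := F) (IsAlgebraic.inv_iff.mp ⟨q, hq, ?_⟩)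
  rw [Polynomial.aeval_def, RatFunc.algebraMap_eq_C]
  exact h

/-- The substitution `f ↦ f(1 / X)`, as an endomorphism of the field of rational functions. -/
def invSubst : RatFunc F →+* RatFunc F where
  toFun := RatFunc.eval RatFunc.C (RatFunc.X)⁻¹
  map_one' := RatFunc.eval_one _ _
  map_zero' := RatFunc.eval_zero _ _
  map_mul' x y := RatFunc.eval_mul _ _ (eval₂_X_inv_ne_zero x.denom_ne_zero)
    (eval₂_X_inv_ne_zero y.denom_ne_zero)
  map_add' x y := RatFunc.eval_add _ _ (eval₂_X_inv_ne_zero x.denom_ne_zero)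
    (eval₂_X_inv_ne_zero y.denom_ne_zero)

theorem invSubst_C (c : F) : invSubst (RatFunc.C c) = RatFunc.C c :=
  RatFunc.eval_C _ _

theorem invSubst_X : invSubst (RatFunc.X : RatFunc F) = RatFunc.X⁻¹ :=
  RatFunc.eval_X _ _

theorem revRat_apply {ι κ : Type*} [Fintype ι] [Fintype κ] (g : ℤ) (G : Matrix ι κ (RatFunc F))
    (i : ι) (j : κ) : revRat g G i j = RatFunc.X ^ g * invSubst (G i j) :=
  rfl

end Reversal

/-! ### Rank, regularity and local equivalence -/

section RankAndRegularity

variable {F : Type*} [Field F]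

/-- A matrix with a nonzero maximal minor has full row rank. -/
theorem rank_eq_card_of_det_submatrix_ne_zero {K ι κ : Type*} [Field K] [Fintype ι]
    [DecidableEq ι] [Fintype κ] (A : Matrix ι κ K) (f : ι → κ)
    (h : (A.submatrix id f).det ≠ 0) : A.rank = Fintype.card ι := by
  classical
  refine le_antisymm A.rank_le_card_height ?_
  have h1 : (A.submatrix id f).rank = Fintype.card ι :=
    Matrix.rank_of_isUnit _ ((Matrix.isUnit_iff_isUnit_det _).mpr h.isUnit)
  have h2 : A.submatrix id f = A * (1 : Matrix κ κ K).submatrix id f := by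
    ext i j
    simp [Matrix.mul_apply, Matrix.one_apply]
  rw [← h1, h2]
  exact Matrix.rank_mul_le_left _ _

theorem definedAt_toRat {ι κ : Type*} (P : Matrix ι κ F[X]) (a : F) : DefinedAt (toRat P) a := by
  intro i j
  simp [toRat]

theorem evalRat_toRat {ι κ : Type*} (P : Matrix ι κ F[X]) (a : F) :
    evalRat a (toRat P) = evalPoly a P := by
  ext i j
  simp [evalRat, toRat, evalPoly, Polynomial.eval₂_id]

variable {ι κ ι' κ' α : Type*} [Fintype ι] [Fintype κ] [Fintype α]

theorem det_evalPoly [DecidableEq ι] (P : Matrix ι ι F[X]) (a : F) :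
    (evalPoly a P).det = P.det.eval a :=
  ((Polynomial.evalRingHom a).map_det P).symm

theorem det_toRat [DecidableEq ι] (P : Matrix ι ι F[X]) :
    (toRat P).det = algebraMap F[X] (RatFunc F) P.det :=
  ((algebraMap F[X] (RatFunc F)).map_det P).symm

theorem regularAt_toRat [DecidableEq ι] {P : Matrix ι ι F[X]} {a : F} (h : P.det.eval a ≠ 0) :
    RegularAt (toRat P) a :=
  ⟨definedAt_toRat P a, by rwa [evalRat_toRat, det_evalPoly]⟩

theorem RegularAt.reindex [Fintype ι'] [DecidableEq ι] [DecidableEq ι']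
    {R : Matrix ι ι (RatFunc F)} {a : F}
    (h : RegularAt R a) (e : ι ≃ ι') : RegularAt (Matrix.reindex e e R) a := by
  refine ⟨fun i j => h.1 _ _, ?_⟩
  have : evalRat a (Matrix.reindex e e R) = Matrix.reindex e e (evalRat a R) := rfl
  rw [this, Matrix.det_reindex_self]
  exact h.2

/-- Equivalence with `diag(G, I)` where the identity block has an arbitrary index type, so that
indices such as `Fin n × Fin m` can be used instead of `Fin (n * m)`. -/
theorem equivUpToIdentityAt_of_mul_eq [DecidableEq ι] [DecidableEq κ] [DecidableEq α]
    {G : Matrix ι κ (RatFunc F)} {H : Matrix ι' κ' (RatFunc F)} {a : F}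
    (e : ι ⊕ α ≃ ι') (f : κ ⊕ α ≃ κ')
    {R₁ : Matrix (ι ⊕ α) (ι ⊕ α) (RatFunc F)} {R₂ : Matrix (κ ⊕ α) (κ ⊕ α) (RatFunc F)}
    (h₁ : RegularAt R₁ a) (h₂ : RegularAt R₂ a)
    (h : R₁ * Matrix.fromBlocks G 0 0 (1 : Matrix α α (RatFunc F)) * R₂ = H.submatrix e f) :
    EquivUpToIdentityAt G H a := by
  let t := Fintype.equivFin α
  let tι : ι ⊕ α ≃ ι ⊕ Fin (Fintype.card α) := Equiv.sumCongr (Equiv.refl ι) t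
  let tκ : κ ⊕ α ≃ κ ⊕ Fin (Fintype.card α) := Equiv.sumCongr (Equiv.refl κ) t
  refine ⟨Fintype.card α, 0, (tι.symm.trans e).trans (Equiv.sumEmpty ι' (Fin 0)).symm,
    (tκ.symm.trans f).trans (Equiv.sumEmpty κ' (Fin 0)).symm,
    Matrix.reindex tι tι R₁, Matrix.reindex tκ tκ R₂, h₁.reindex tι, h₂.reindex tκ, ?_⟩
  have hG : diagId G (Fintype.card α) =
      Matrix.reindex tι tκ (Matrix.fromBlocks G 0 0 (1 : Matrix α α (RatFunc F))) := by
    ext i j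
    rcases i with i | i <;> rcases j with j | j <;>
      simp [diagId, tι, tκ, Matrix.one_apply]
  rw [hG]
  simp only [Matrix.reindex_apply, Matrix.submatrix_mul_equiv]
  rw [h]
  ext i j
  rcases i with i | i
  · rcases j with j | j
    · simp [diagId]
    · exact j.elim0
  · exact i.elim0

end RankAndRegularity

/-! ### Pencils whose lower block has an explicit kernel -/

section Kernel

variable {F : Type*} [Field F] {n m : ℕ}

/-- The block column `[r₀ I; …; rₖ₋₁ I]`, that is, `r ⊗ I`. -/
def blockColumn {R : Type*} [Zero R] (m : ℕ) {k : ℕ} (r : Fin k → R) :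
    Matrix (Fin k × Fin m) (Fin m) R :=
  fun jb b => if jb.2 = b then r jb.1 else 0

theorem mul_blockColumn_apply {R ι : Type*} {k : ℕ} [Semiring R]
    (A : Matrix ι (Fin k × Fin m) R) (r : Fin k → R) (i : ι) (b : Fin m) :
    (A * blockColumn m r) i b = ∑ j, A i (j, b) * r j := by
  simp [Matrix.mul_apply, blockColumn, Fintype.sum_prod_type]

theorem toRat_kronecker_one_apply (B : Matrix (Fin n) (Fin (n + 1)) F[X])
    (ib : Fin n × Fin m) (jb : Fin (n + 1) × Fin m) :
    toRat (B ⊗ₖ (1 : Matrix (Fin m) (Fin m) F[X])) ib jb =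
      if ib.2 = jb.2 then algebraMap F[X] (RatFunc F) (B ib.1 jb.1) else 0 := by
  simp only [toRat, Matrix.map_apply, Matrix.kroneckerMap_apply, Matrix.one_apply]
  split_ifs <;> simp

theorem toRat_kronecker_one_mul_blockColumn (B : Matrix (Fin n) (Fin (n + 1)) F[X])
    {r : Fin (n + 1) → RatFunc F}
    (hr : ∀ i, ∑ j, algebraMap F[X] (RatFunc F) (B i j) * r j = 0) :
    toRat (B ⊗ₖ (1 : Matrix (Fin m) (Fin m) F[X])) * blockColumn m r = 0 := by
  ext ib b
  rw [mul_blockColumn_apply]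
  simp only [toRat_kronecker_one_apply, Matrix.zero_apply]
  split_ifs with h
  · exact hr ib.1
  · simp

/-- The indices of the columns outside the block column `p`. -/
def otherColumns (m : ℕ) (p : Fin (n + 1)) (jb : Fin n × Fin m) : Fin (n + 1) × Fin m :=
  (p.succAbove jb.1, jb.2)

/-- Deleting the block column `p` of `B ⊗ I` leaves `B' ⊗ I`, with `B'` a maximal minor of `B`. -/
theorem eval_det_kronecker_submatrix_ne_zero {B : Matrix (Fin n) (Fin (n + 1)) F[X]}
    {p : Fin (n + 1)} {a : F} (h : (B.submatrix id p.succAbove).det.eval a ≠ 0) :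
    ((B ⊗ₖ (1 : Matrix (Fin m) (Fin m) F[X])).submatrix id (otherColumns m p)).det.eval a ≠ 0 := by
  have : (B ⊗ₖ (1 : Matrix (Fin m) (Fin m) F[X])).submatrix id (otherColumns m p) =
      (B.submatrix id p.succAbove) ⊗ₖ (1 : Matrix (Fin m) (Fin m) F[X]) := rfl
  rw [this, Matrix.det_kronecker]
  simp [h]

/-- The column indices of `L`, with the block column `p` moved to the front. -/
def pivotEquiv (m : ℕ) (p : Fin (n + 1)) : Fin m ⊕ Fin n × Fin m ≃ Fin (n + 1) × Fin m :=
  Equiv.ofBijective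
    (Sum.elim (fun b => (p, b)) (otherColumns m p)) <| by
    constructor
    · rintro (b | ⟨j, b⟩) (b' | ⟨j', b'⟩) h
      · simpa using h
      · exact absurd (congrArg Prod.fst h).symm (p.succAbove_ne j')
      · exact absurd (congrArg Prod.fst h) (p.succAbove_ne j)
      · simpa [otherColumns] using h
    · rintro ⟨j, b⟩
      rcases eq_or_ne j p with rfl | hj
      · exact ⟨Sum.inl b, rfl⟩
      · obtain ⟨k, rfl⟩ := Fin.exists_succAbove_eq hj
        exact ⟨Sum.inr (k, b), rfl⟩

theorem pivotEquiv_inl (p : Fin (n + 1)) (b : Fin m) :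
    pivotEquiv m p (Sum.inl b) = (p, b) := rfl

theorem pivotEquiv_inr (p : Fin (n + 1)) (jb : Fin n × Fin m) :
    pivotEquiv m p (Sum.inr jb) = (p.succAbove jb.1, jb.2) := rfl

/-- The column operation `[d I, 0; -r', I]` is regular wherever `d` is a unit and `r'` has no
poles. -/
theorem regularAt_fromBlocks_smul_one {α : Type*} [Fintype α] [DecidableEq α] {a : F}
    {d : RatFunc F} {E : Matrix α (Fin m) (RatFunc F)}
    (hd : UnitFunAt a d) (hE : ∀ i j, RegularFunAt a (E i j)) :
    RegularAt (Matrix.fromBlocks (d • (1 : Matrix (Fin m) (Fin m) (RatFunc F))) 0 E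
      (1 : Matrix α α (RatFunc F))) a := by
  have h0 : RegularFunAt a (0 : RatFunc F) := ⟨0, 1, by simp, by simp⟩
  have h1 : RegularFunAt a (1 : RatFunc F) := ⟨1, 1, by simp, by simp⟩
  constructor
  · rintro (i | i) (j | j) <;> apply RegularFunAt.denom_ne_zero
    · by_cases h : i = j <;> simp [h, h0, hd.regularFunAt]
    · exact h0
    · exact hE i j
    · by_cases h : i = j <;> simp [h, h0, h1]
  · have : evalRat a (Matrix.fromBlocks (d • (1 : Matrix (Fin m) (Fin m) (RatFunc F))) 0 E
      (1 : Matrix α α (RatFunc F))) =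
        Matrix.fromBlocks (RatFunc.eval (RingHom.id F) a d • (1 : Matrix (Fin m) (Fin m) F)) 0
          (evalRat a E) 1 := by
      ext i j
      rcases i with i | i <;> rcases j with j | j
      · by_cases h : i = j <;> simp [evalRat, h]
      · simp [evalRat]
      · simp [evalRat]
      · by_cases h : i = j <;> simp [evalRat, h]
    rw [this, Matrix.det_fromBlocks_zero₁₂, Matrix.det_smul]
    simp [hd.eval_ne_zero]

/-- Suppose that `r` spans the kernel of `B`, normalized by `r p = 1`, and that
`M (r ⊗ I) = d G`. Let `M'` and `B'` be `M` and `B` without the (block) column `p`. Then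
`[M; B ⊗ I]` equals `[I, M'; 0, B' ⊗ I] diag(G, I) [d I, 0; -r', I]` once the block column `p` is
moved to the front. -/
theorem equivUpToIdentityAt_of_kernel (p : Fin (n + 1))
    (M : Matrix (Fin m) (Fin (n + 1) × Fin m) F[X]) (B : Matrix (Fin n) (Fin (n + 1)) F[X])
    {G : Matrix (Fin m) (Fin m) (RatFunc F)} {r : Fin (n + 1) → RatFunc F} {d : RatFunc F} {a : F}
    (hr : ∀ j, RegularFunAt a (r j)) (hp : r p = 1) (hd : UnitFunAt a d)
    (hB : (B.submatrix id p.succAbove).det.eval a ≠ 0)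
    (hK : ∀ i, ∑ j, algebraMap F[X] (RatFunc F) (B i j) * r j = 0)
    (hG : toRat M * blockColumn m r = d • G) :
    EquivUpToIdentityAt G
      (toRat (Matrix.fromRows M (B ⊗ₖ (1 : Matrix (Fin m) (Fin m) F[X])))) a := by
  set K := B ⊗ₖ (1 : Matrix (Fin m) (Fin m) F[X]) with hKdef
  let E : Matrix (Fin n × Fin m) (Fin m) (RatFunc F) :=
    -blockColumn m fun j => r (p.succAbove j)
  have hE : ∀ jb b, RegularFunAt a (E jb b) := by
    intro jb b
    apply RegularFunAt.neg
    unfold blockColumn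
    split_ifs
    · exact hr _
    · exact ⟨0, 1, by simp, by simp⟩
  have hU : RegularAt (toRat (Matrix.fromBlocks (1 : Matrix (Fin m) (Fin m) F[X])
      (M.submatrix id (otherColumns m p)) 0 (K.submatrix id (otherColumns m p)))) a := by
    apply regularAt_toRat
    rw [Matrix.det_fromBlocks_zero₂₁, Matrix.det_one, one_mul]
    exact eval_det_kronecker_submatrix_ne_zero hB
  refine equivUpToIdentityAt_of_mul_eq (Equiv.refl _) (pivotEquiv m p) hU
    (regularAt_fromBlocks_smul_one hd hE) ?_
  have hU' : toRat (Matrix.fromBlocks (1 : Matrix (Fin m) (Fin m) F[X])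
      (M.submatrix id (otherColumns m p)) 0 (K.submatrix id (otherColumns m p))) =
      Matrix.fromBlocks 1 ((toRat M).submatrix id (otherColumns m p)) 0
        ((toRat K).submatrix id (otherColumns m p)) := by
    ext i j
    rcases i with i | i <;> rcases j with j | j
    · by_cases h : i = j <;> simp [toRat, h]
    · simp [toRat]
    · simp [toRat]
    · simp [toRat]
  -- Since `r p = 1`, the summand `j = p` of `A (r ⊗ I)` is the block column `p` of `A`.
  have split : ∀ {ι : Type} (A : Matrix ι (Fin (n + 1) × Fin m) (RatFunc F)) (i : ι) (b : Fin m),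
      (A.submatrix id (otherColumns m p) * E) i b = A i (p, b) - (A * blockColumn m r) i b := by
    intro ι A i b
    rw [mul_blockColumn_apply, Fin.sum_univ_succAbove _ p, hp, Matrix.mul_neg, Matrix.neg_apply,
      mul_blockColumn_apply]
    simp [otherColumns]
  rw [hU', Matrix.fromBlocks_multiply, Matrix.fromBlocks_multiply]
  ext i j
  rcases i with i | i <;> rcases j with j | j
  · simp only [Matrix.fromBlocks_apply₁₁, Matrix.add_apply, Matrix.one_mul, Matrix.mul_zero,
      Matrix.mul_one, zero_add, add_zero, split, hG]
    simp [pivotEquiv_inl, toRat]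
  · simp [pivotEquiv_inr, toRat, otherColumns]
  · simp only [Matrix.fromBlocks_apply₂₁, Matrix.zero_mul, Matrix.mul_zero,
      Matrix.mul_one, zero_add, add_zero, split, hKdef, toRat_kronecker_one_mul_blockColumn B hK]
    simp [pivotEquiv_inl, toRat]
  · simp [pivotEquiv_inr, toRat, otherColumns]

theorem isPencil_iff {ι κ : Type*} [Fintype ι] [Fintype κ] (P : Matrix ι κ F[X]) :
    IsPencil P ↔ ∀ i j, (P i j).natDegree ≤ 1 := by
  simp [IsPencil, degree, Finset.sup_le_iff]

theorem rank_of_isEmpty_rows {K ι κ : Type*} [Field K] [Fintype ι] [IsEmpty ι] [Fintype κ]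
    (A : Matrix ι κ K) : A.rank = Fintype.card ι :=
  le_antisymm A.rank_le_card_height (by simp)

/-- With the notation of `equivUpToIdentityAt_of_kernel`, the rows of `d⁻¹ (r ⊗ I)ᵀ` form a basis
dual to `B ⊗ I` that recovers `G` from `M`. -/
theorem isBlockFullRankPencilAssociatedIn_of_kernel (p : Fin (n + 1))
    (M : Matrix (Fin m) (Fin (n + 1) × Fin m) F[X]) (B : Matrix (Fin n) (Fin (n + 1)) F[X])
    {G : Matrix (Fin m) (Fin m) (RatFunc F)} {r : Fin (n + 1) → RatFunc F} {d : RatFunc F}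
    {S : Set F} (hS : S.Nonempty)
    (hL : IsPencil (Matrix.fromRows M (B ⊗ₖ (1 : Matrix (Fin m) (Fin m) F[X]))))
    (hr : ∀ a ∈ S, ∀ j, RegularFunAt a (r j)) (hp : r p = 1) (hd : ∀ a ∈ S, UnitFunAt a d)
    (hB : ∀ a ∈ S, (B.submatrix id p.succAbove).det.eval a ≠ 0)
    (hK : ∀ i, ∑ j, algebraMap F[X] (RatFunc F) (B i j) * r j = 0)
    (hG : toRat M * blockColumn m r = d • G) :
    IsBlockFullRankPencilAssociatedIn
      (oneBlockColumn (Matrix.fromRows M (B ⊗ₖ (1 : Matrix (Fin m) (Fin m) F[X])))) G S := by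
  set K := B ⊗ₖ (1 : Matrix (Fin m) (Fin m) F[X]) with hKdef
  have h₁₁ : (oneBlockColumn (Matrix.fromRows M K)).toBlocks₁₁ = M := rfl
  have h₂₁ : (oneBlockColumn (Matrix.fromRows M K)).toBlocks₂₁ = K := rfl
  obtain ⟨a₀, ha₀⟩ := hS
  have hd0 : d ≠ 0 := (hd a₀ ha₀).ne_zero
  have hKS : ∀ a ∈ S, (K.submatrix id (otherColumns m p)).det.eval a ≠ 0 := fun a ha =>
    eval_det_kronecker_submatrix_ne_zero (hB a ha)
  have hKrank : FullRowNormalRank (toRat K) := by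
    apply rank_eq_card_of_det_submatrix_ne_zero _ (otherColumns m p)
    have : (toRat K).submatrix id (otherColumns m p) =
        toRat (K.submatrix id (otherColumns m p)) := rfl
    rw [this, det_toRat]
    apply RatFunc.algebraMap_ne_zero
    intro h0
    apply hKS a₀ ha₀
    rw [h0, Polynomial.eval_zero]
  have hKfull : FullRowRankIn (toRat K) S := by
    refine fun a ha => ⟨definedAt_toRat K a, ?_⟩
    apply rank_eq_card_of_det_submatrix_ne_zero _ (otherColumns m p)
    have : (evalRat a (toRat K)).submatrix id (otherColumns m p) =
        evalPoly a (K.submatrix id (otherColumns m p)) := by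
      rw [evalRat_toRat]; rfl
    rw [this, det_evalPoly]
    exact hKS a ha
  let H : Matrix (Fin m) (Fin (n + 1) × Fin m) (RatFunc F) :=
    (blockColumn m fun j => r j * d⁻¹).transpose
  have hHdiag : H.submatrix id (fun b : Fin m => (p, b)) = Matrix.diagonal fun _ => d⁻¹ := by
    ext b b'
    by_cases h : b' = b
    · subst h; simp [H, blockColumn, hp]
    · simp [H, blockColumn, h, Ne.symm h]
  have hHrank : FullRowNormalRank H := by
    apply rank_eq_card_of_det_submatrix_ne_zero _ fun b : Fin m => (p, b)
    rw [hHdiag, Matrix.det_diagonal]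
    simp [hd0]
  have hHfull : FullRowRankIn H S := by
    refine fun a ha => ⟨?_, ?_⟩
    · rintro b ⟨j, b'⟩
      simp only [H, blockColumn, Matrix.transpose_apply]
      split_ifs
      · exact ((hr a ha j).mul (hd a ha).inv.regularFunAt).denom_ne_zero
      · simp
    · apply rank_eq_card_of_det_submatrix_ne_zero _ fun b : Fin m => (p, b)
      have : (evalRat a H).submatrix id (fun b : Fin m => (p, b)) =
          Matrix.diagonal fun _ => RatFunc.eval (RingHom.id F) a d⁻¹ := by
        have : (evalRat a H).submatrix id (fun b : Fin m => (p, b)) =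
          evalRat a (H.submatrix id (fun b : Fin m => (p, b))) := rfl
        rw [this, hHdiag]
        ext b b'
        by_cases h : b = b'
        · subst h; simp [evalRat]
        · simp [evalRat, h]
      rw [this, Matrix.det_diagonal]
      simp [(hd a ha).inv.eval_ne_zero]
  have hcol : blockColumn m (fun j => r j * d⁻¹) = d⁻¹ • blockColumn m r := by
    ext jb b
    simp only [blockColumn, Matrix.smul_apply, smul_eq_mul]
    split_ifs
    · ring
    · simp
  have hone : FullRowNormalRank (1 : Matrix (Fin m) (Fin m) (RatFunc F)) := Matrix.rank_one
  have honeS : FullRowRankIn (1 : Matrix (Fin m) (Fin m) (RatFunc F)) S := by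
    refine fun a _ => ⟨fun i j => ?_, ?_⟩
    · rcases eq_or_ne i j with rfl | h
      · simp
      · simp [h]
    · have : evalRat a (1 : Matrix (Fin m) (Fin m) (RatFunc F)) = 1 := by
        ext i j
        rcases eq_or_ne i j with rfl | h
        · simp [evalRat]
        · simp [evalRat, h]
      rw [this, Matrix.rank_one]
  refine ⟨⟨?_, ?_, ?_, rank_of_isEmpty_rows _⟩, ⟨a₀, ha₀⟩, H, 1, ⟨?_, hHrank, ?_, ?_⟩,
    ⟨rank_of_isEmpty_rows _, hone, by simp, ?_⟩, ?_, ?_, hHfull, ?_, ?_⟩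
  · rw [isPencil_iff] at hL ⊢
    rintro i (j | j)
    · exact hL i j
    · exact j.elim
  · ext i j
    exact j.elim
  · rwa [h₂₁]
  · rwa [h₂₁]
  · simp only [Fintype.card_prod, Fintype.card_fin]
    ring
  · rw [h₂₁]
    simp only [H, Matrix.transpose_transpose, hcol, Matrix.mul_smul, hKdef,
      toRat_kronecker_one_mul_blockColumn B hK, smul_zero]
  · ext i j
    exact i.elim
  · rwa [h₂₁]
  · exact fun a _ => ⟨fun i => i.elim, rank_of_isEmpty_rows _⟩
  · exact honeS
  · rw [h₁₁, Matrix.one_mul]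
    simp only [H, Matrix.transpose_transpose, hcol, Matrix.mul_smul, hG]
    rw [smul_smul, inv_mul_cancel₀ hd0, one_smul]

end Kernel

/-! ### Bidiagonal pencils and two-term recurrences -/

section Recurrence

variable {F : Type*} [Field F] {n m : ℕ}

/-- The bidiagonal matrix of `bidiagonal`, for arbitrary polynomials `g k` and `h k`, so that it
also covers the reversal of the pencil. -/
def bidiagonalOf (n : ℕ) (g h : ℕ → F[X]) : Matrix (Fin n) (Fin (n + 1)) F[X] :=
  fun i j => if (j : ℕ) = i then -h i else if (j : ℕ) = i + 1 then g (i + 1) else 0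

/-- The top block row of the pencil, for arbitrary polynomials `g k` and `h k`, and with the
constant `c` in place of `1 / β N`. -/
def topRowOf (n : ℕ) (c : F) (g h : ℕ → F[X]) (D : ℕ → Matrix (Fin m) (Fin m) F) :
    Matrix (Fin m) (Fin (n + 1) × Fin m) F[X] :=
  fun a jb =>
    Polynomial.C c * g (n + 1) * Polynomial.C (D jb.1 a jb.2) +
      if (jb.1 : ℕ) = n then Polynomial.C c * h n * Polynomial.C (D (n + 1) a jb.2) else 0

/-- The pencil `[M; B ⊗ I]` built from arbitrary polynomials `g k` and `h k`, with `n + 1` block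
columns, that is, `N = n + 1`. -/
def pencilOf (n : ℕ) (c : F) (g h : ℕ → F[X]) (D : ℕ → Matrix (Fin m) (Fin m) F) :
    Matrix (Fin m ⊕ Fin n × Fin m) (Fin (n + 1) × Fin m) F[X] :=
  Matrix.fromRows (topRowOf n c g h D)
    (bidiagonalOf n g h ⊗ₖ (1 : Matrix (Fin m) (Fin m) F[X]))

theorem LMat_eq_pencilOf (σ β : ℕ → F) (ξ : ℕ → OnePoint F) (D : ℕ → Matrix (Fin m) (Fin m) F) :
    LMat (n + 1) σ β ξ D = pencilOf n (β (n + 1))⁻¹ (gFun β ξ) (hFun σ) D :=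
  rfl

/-- Deleting the first column of the bidiagonal matrix leaves a lower triangular matrix. -/
theorem det_bidiagonalOf_zero (g h : ℕ → F[X]) :
    ((bidiagonalOf n g h).submatrix id (Fin.succAbove 0)).det = ∏ i : Fin n, g (i + 1) := by
  rw [Matrix.det_of_isLowerTriangular]
  · refine Finset.prod_congr rfl fun i _ => ?_
    simp [bidiagonalOf]
  · intro i j hij
    have hij' : (i : ℕ) < j := hij
    simp only [bidiagonalOf, Matrix.submatrix_apply, id, Fin.succAbove_zero, Fin.val_succ]
    rw [if_neg (by omega), if_neg (by omega)]

/-- Deleting the last column of the bidiagonal matrix leaves an upper triangular matrix. -/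
theorem det_bidiagonalOf_last (g h : ℕ → F[X]) :
    ((bidiagonalOf n g h).submatrix id (Fin.succAbove (Fin.last n))).det =
      ∏ i : Fin n, -h i := by
  rw [Matrix.det_of_isUpperTriangular]
  · refine Finset.prod_congr rfl fun i _ => ?_
    simp [bidiagonalOf]
  · intro i j hij
    have hij' : (j : ℕ) < i := hij
    simp only [bidiagonalOf, Matrix.submatrix_apply, id, Fin.succAbove_last, Fin.val_castSucc]
    rw [if_neg (by omega), if_neg (by omega)]

variable {g h : ℕ → F[X]} {b : ℕ → RatFunc F}

theorem sum_bidiagonalOf_mul (x : RatFunc F)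
    (hrec : ∀ i ≤ n, b (i + 1) * algebraMap F[X] (RatFunc F) (g (i + 1)) =
      b i * algebraMap F[X] (RatFunc F) (h i)) (i : Fin n) :
    ∑ j : Fin (n + 1), algebraMap F[X] (RatFunc F) (bidiagonalOf n g h i j) * (b j / x) = 0 := by
  have hne : i.succ ≠ i.castSucc := by
    intro e
    have := congrArg Fin.val e
    simp at this
  have hsplit : ∀ j : Fin (n + 1),
      algebraMap F[X] (RatFunc F) (bidiagonalOf n g h i j) * (b j / x) =
        (if j = i.castSucc then -(algebraMap F[X] (RatFunc F) (h i) * (b i / x)) else 0) +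
          if j = i.succ then algebraMap F[X] (RatFunc F) (g (i + 1)) * (b (i + 1) / x) else 0 := by
    intro j
    by_cases h1 : j = i.castSucc
    · subst h1
      simp [bidiagonalOf, hne.symm]
    · by_cases h2 : j = i.succ
      · subst h2
        simp [bidiagonalOf, hne]
      · have h1' : (j : ℕ) ≠ i := fun e => h1 (Fin.ext (by simpa using e))
        have h2' : (j : ℕ) ≠ i + 1 := fun e => h2 (Fin.ext (by simpa using e))
        simp [bidiagonalOf, h1, h2, h1', h2']
  rw [Finset.sum_congr rfl fun j _ => hsplit j, Finset.sum_add_distrib]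
  simp only [Finset.sum_ite_eq', Finset.mem_univ, if_true]
  have := hrec i i.2.le
  linear_combination this / x

theorem toRat_topRowOf_mul_blockColumn (c : F) (D : ℕ → Matrix (Fin m) (Fin m) F)
    {x : RatFunc F}
    (hrec : ∀ i ≤ n, b (i + 1) * algebraMap F[X] (RatFunc F) (g (i + 1)) =
      b i * algebraMap F[X] (RatFunc F) (h i)) :
    toRat (topRowOf n c g h D) * blockColumn m (fun j : Fin (n + 1) => b j / x) =
      (RatFunc.C c * algebraMap F[X] (RatFunc F) (g (n + 1)) / x) •
        ∑ i ∈ Finset.range (n + 2), b i • (D i).map RatFunc.C := by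
  ext i k
  rw [mul_blockColumn_apply]
  have hentry : ∀ j : Fin (n + 1),
      toRat (topRowOf n c g h D) i (j, k) * (b j / x) =
        RatFunc.C c * algebraMap F[X] (RatFunc F) (g (n + 1)) / x *
            (b j * RatFunc.C (D j i k)) +
          if j = Fin.last n then RatFunc.C c * algebraMap F[X] (RatFunc F) (h n) / x *
            (b n * RatFunc.C (D (n + 1) i k)) else 0 := by
    intro j
    by_cases hj : j = Fin.last n
    · subst hj
      simp only [toRat, topRowOf, Matrix.map_apply, Fin.val_last, if_true, map_add, map_mul,
        RatFunc.algebraMap_C]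
      ring
    · have hj' : (j : ℕ) ≠ n := fun e => hj (Fin.ext e)
      simp only [toRat, topRowOf, Matrix.map_apply, hj, hj', if_false, map_mul, add_zero,
        RatFunc.algebraMap_C]
      ring
  rw [Finset.sum_congr rfl fun j _ => hentry j, Finset.sum_add_distrib, ← Finset.mul_sum,
    Finset.sum_range_succ, Matrix.smul_apply, Matrix.add_apply, Matrix.sum_apply,
    Fin.sum_univ_eq_sum_range (fun j => b j * RatFunc.C (D j i k)) (n + 1)]
  simp only [Finset.sum_ite_eq', Finset.mem_univ, if_true, Matrix.smul_apply, Matrix.map_apply,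
    smul_eq_mul]
  have := hrec n le_rfl
  linear_combination -(RatFunc.C c / x * RatFunc.C (D (n + 1) i k)) * this

/-- The functions `b j / b p` satisfy the kernel equations of the bidiagonal matrix, so that
`equivUpToIdentityAt_of_kernel` applies with the pivot `p`. -/
theorem equivUpToIdentityAt_pencilOf (p : Fin (n + 1)) (c : F)
    (D : ℕ → Matrix (Fin m) (Fin m) F) {a : F}
    (hrec : ∀ i ≤ n, b (i + 1) * algebraMap F[X] (RatFunc F) (g (i + 1)) =
      b i * algebraMap F[X] (RatFunc F) (h i))
    (hp : b p ≠ 0) (hr : ∀ j : Fin (n + 1), RegularFunAt a (b j / b p))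
    (hd : UnitFunAt a (RatFunc.C c * algebraMap F[X] (RatFunc F) (g (n + 1)) / b p))
    (hB : ((bidiagonalOf n g h).submatrix id p.succAbove).det.eval a ≠ 0) :
    EquivUpToIdentityAt (∑ i ∈ Finset.range (n + 2), b i • (D i).map RatFunc.C)
      (toRat (pencilOf n c g h D)) a :=
  equivUpToIdentityAt_of_kernel p _ _ hr (div_self hp) hd hB
    (sum_bidiagonalOf_mul (b p) hrec) (toRat_topRowOf_mul_blockColumn c D hrec)

theorem isBlockFullRankPencilAssociatedIn_pencilOf (p : Fin (n + 1)) (c : F)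
    (D : ℕ → Matrix (Fin m) (Fin m) F) {S : Set F} (hS : S.Nonempty)
    (hL : IsPencil (pencilOf n c g h D))
    (hrec : ∀ i ≤ n, b (i + 1) * algebraMap F[X] (RatFunc F) (g (i + 1)) =
      b i * algebraMap F[X] (RatFunc F) (h i))
    (hp : b p ≠ 0) (hr : ∀ a ∈ S, ∀ j : Fin (n + 1), RegularFunAt a (b j / b p))
    (hd : ∀ a ∈ S,
      UnitFunAt a (RatFunc.C c * algebraMap F[X] (RatFunc F) (g (n + 1)) / b p))
    (hB : ∀ a ∈ S, ((bidiagonalOf n g h).submatrix id p.succAbove).det.eval a ≠ 0) :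
    IsBlockFullRankPencilAssociatedIn (oneBlockColumn (pencilOf n c g h D))
      (∑ i ∈ Finset.range (n + 2), b i • (D i).map RatFunc.C) S :=
  isBlockFullRankPencilAssociatedIn_of_kernel p _ _ hS hL hr (div_self hp) hd hB
    (sum_bidiagonalOf_mul (b p) hrec) (toRat_topRowOf_mul_blockColumn c D hrec)

/-- Where the `g k` do not vanish, the recurrence determines every `b j` from `b 0`. -/
theorem regularFunAt_div_first {a : F}
    (hrec : ∀ i ≤ n, b (i + 1) * algebraMap F[X] (RatFunc F) (g (i + 1)) =
      b i * algebraMap F[X] (RatFunc F) (h i))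
    (h0 : b 0 ≠ 0) (hg : ∀ k, 1 ≤ k → k ≤ n → (g k).eval a ≠ 0) :
    ∀ j ≤ n, RegularFunAt a (b j / b 0) := by
  intro j
  induction j with
  | zero => exact fun _ => ⟨1, 1, by simp, by simp [h0]⟩
  | succ j ih =>
    intro hj
    have hu : UnitFunAt a (algebraMap F[X] (RatFunc F) (g (j + 1))) :=
      unitFunAt_algebraMap (hg _ (by omega) hj)
    have : b (j + 1) / b 0 = b j / b 0 * algebraMap F[X] (RatFunc F) (h j) *
        (algebraMap F[X] (RatFunc F) (g (j + 1)))⁻¹ := by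
      rw [eq_mul_inv_iff_mul_eq₀ hu.ne_zero]
      linear_combination (hrec j (by omega)) / b 0
    rw [this]
    exact ((ih (by omega)).mul (regularFunAt_algebraMap _)).mul hu.inv.regularFunAt

/-- Where the `h k` do not vanish, the recurrence determines every `b j` from `b n`. -/
theorem regularFunAt_div_last {a : F}
    (hrec : ∀ i ≤ n, b (i + 1) * algebraMap F[X] (RatFunc F) (g (i + 1)) =
      b i * algebraMap F[X] (RatFunc F) (h i))
    (hn : b n ≠ 0) (hh : ∀ k < n, (h k).eval a ≠ 0) :
    ∀ j ≤ n, RegularFunAt a (b j / b n) := by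
  intro j hj
  induction hj using Nat.decreasingInduction with
  | self => exact ⟨1, 1, by simp, by simp [hn]⟩
  | of_succ j hj ih =>
    have hu : UnitFunAt a (algebraMap F[X] (RatFunc F) (h j)) :=
      unitFunAt_algebraMap (hh _ hj)
    have : b j / b n = b (j + 1) / b n * algebraMap F[X] (RatFunc F) (g (j + 1)) *
        (algebraMap F[X] (RatFunc F) (h j))⁻¹ := by
      rw [eq_mul_inv_iff_mul_eq₀ hu.ne_zero]
      linear_combination -(hrec j (by omega)) / b n
    rw [this]
    exact (ih.mul (regularFunAt_algebraMap _)).mul hu.inv.regularFunAt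

end Recurrence

/-! ### The linear factors and the rational basis functions -/

section Parameters

variable {F : Type*} [Field F] {σ β : ℕ → F} {ξ : ℕ → OnePoint F}

theorem natDegree_hFun_le (k : ℕ) : (hFun σ k).natDegree ≤ 1 := by
  simp [hFun]

theorem natDegree_gFun_le (k : ℕ) : (gFun β ξ k).natDegree ≤ 1 := by
  refine (Polynomial.natDegree_C_mul_le _ _).trans ?_
  unfold poleFactor
  split
  · simp
  · refine (Polynomial.natDegree_sub_le _ _).trans (max_le (by simp) ?_)
    exact (Polynomial.natDegree_C_mul_le _ _).trans Polynomial.natDegree_X_le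

theorem gFun_of_eq_infty {k : ℕ} (h : ξ k = OnePoint.infty) :
    gFun β ξ k = Polynomial.C (β k) := by
  rw [gFun, h]
  exact mul_one _

theorem gFun_of_eq_coe {k : ℕ} {x : F} (h : ξ k = (x : OnePoint F)) :
    gFun β ξ k = Polynomial.C (β k) * (1 - Polynomial.C x⁻¹ * Polynomial.X) := by
  rw [gFun, h]
  rfl

theorem eval_zero_gFun (k : ℕ) : (gFun β ξ k).eval 0 = β k := by
  unfold gFun poleFactor
  split <;> simp

theorem gFun_ne_zero {k : ℕ} (hβ : β k ≠ 0) : gFun β ξ k ≠ 0 := by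
  intro h
  apply hβ
  rw [← eval_zero_gFun (β := β) (ξ := ξ), h, Polynomial.eval_zero]

theorem eval_gFun_ne_zero {k : ℕ} {a : F} (hβ : β k ≠ 0) (hξ : ξ k ≠ ((0 : F) : OnePoint F))
    (ha : ξ k ≠ (a : OnePoint F)) : (gFun β ξ k).eval a ≠ 0 := by
  by_cases h : ξ k = OnePoint.infty
  · rw [gFun_of_eq_infty h]
    simpa using hβ
  · obtain ⟨x, hx⟩ := OnePoint.ne_infty_iff_exists.mp h
    rw [gFun_of_eq_coe hx.symm]
    have hx0 : x ≠ 0 := by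
      rintro rfl
      exact hξ hx.symm
    have hxa : x ≠ a := by
      rintro rfl
      exact ha hx.symm
    simp only [Polynomial.eval_mul, Polynomial.eval_C, Polynomial.eval_sub, Polynomial.eval_one,
      Polynomial.eval_X]
    refine mul_ne_zero hβ fun h0 => hxa ?_
    field_simp at h0
    linear_combination h0

theorem bFun_succ_mul {i : ℕ} (hβ : β (i + 1) ≠ 0) :
    bFun σ β ξ (i + 1) * algebraMap F[X] (RatFunc F) (gFun β ξ (i + 1)) =
      bFun σ β ξ i * algebraMap F[X] (RatFunc F) (hFun σ i) := by
  have hg : algebraMap F[X] (RatFunc F) (gFun β ξ (i + 1)) ≠ 0 :=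
    RatFunc.algebraMap_ne_zero (gFun_ne_zero hβ)
  unfold bFun
  rw [Finset.prod_Icc_succ_top (by omega), Nat.add_sub_cancel]
  field_simp

theorem bFun_zero : bFun σ β ξ 0 = RatFunc.C (β 0)⁻¹ := by
  simp [bFun]

theorem isPencil_pencilOf {n m : ℕ} (c : F) {g h : ℕ → F[X]} (D : ℕ → Matrix (Fin m) (Fin m) F)
    (hg : ∀ k, (g k).natDegree ≤ 1) (hh : ∀ k, (h k).natDegree ≤ 1) :
    IsPencil (pencilOf n c g h D) := by
  rw [isPencil_iff]
  have key : ∀ (p : F[X]) (u v : F), p.natDegree ≤ 1 →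
      (Polynomial.C u * p * Polynomial.C v).natDegree ≤ 1 := fun p u v hp =>
    (Polynomial.natDegree_mul_C_le _ _).trans ((Polynomial.natDegree_C_mul_le _ _).trans hp)
  rintro (i | ⟨i, k⟩) ⟨j, l⟩
  · have hlast : (if (j : ℕ) = n then
        Polynomial.C c * h n * Polynomial.C (D (n + 1) i l) else 0).natDegree ≤ 1 := by
      split_ifs
      · exact key _ _ _ (hh _)
      · simp
    exact Polynomial.natDegree_add_le_of_degree_le (key _ _ _ (hg _)) hlast
  · change (bidiagonalOf n g h i j * (1 : Matrix (Fin m) (Fin m) F[X]) k l).natDegree ≤ 1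
    have hB : (bidiagonalOf n g h i j).natDegree ≤ 1 := by
      unfold bidiagonalOf
      split_ifs
      · rw [Polynomial.natDegree_neg]
        exact hh _
      · exact hg _
      · simp
    rw [Matrix.one_apply]
    split_ifs
    · simpa using hB
    · simp

theorem isPencil_LMat {n m : ℕ} (D : ℕ → Matrix (Fin m) (Fin m) F) :
    IsPencil (LMat (n + 1) σ β ξ D) :=
  isPencil_pencilOf _ D natDegree_gFun_le natDegree_hFun_le

/-- For `N ≥ 2` and nonempty blocks, the entry `-h 0` forces the pencil to have degree one. -/
theorem degree_LMat {n m : ℕ} (hn : 1 ≤ n) (hm : 1 ≤ m) (D : ℕ → Matrix (Fin m) (Fin m) F) :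
    degree (LMat (n + 1) σ β ξ D) = 1 := by
  refine le_antisymm (isPencil_LMat D) ?_
  have hentry : LMat (n + 1) σ β ξ D (Sum.inr (⟨0, hn⟩, ⟨0, hm⟩)) (⟨0, by omega⟩, ⟨0, hm⟩) =
      -hFun σ 0 := by
    rw [LMat_eq_pencilOf]
    simp [pencilOf, bidiagonalOf]
  have h1 : (-hFun σ 0).natDegree = 1 := by
    rw [Polynomial.natDegree_neg]
    exact Polynomial.natDegree_X_sub_C _
  rw [← hentry] at h1
  refine h1.ge.trans ?_
  exact le_trans
    (Finset.le_sup (f := fun j => (LMat (n + 1) σ β ξ D _ j).natDegree) (Finset.mem_univ _))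
    (Finset.le_sup (f := fun i => Finset.univ.sup fun j =>
      (LMat (n + 1) σ β ξ D i j).natDegree) (Finset.mem_univ _))

end Parameters

/-! ### The pencil at infinity -/

section ReversedPencil

variable {F : Type*} [Field F]

/-- The reversal `X * p(1 / X)` of a polynomial `p` of degree at most one. -/
def revLinear (p : F[X]) : F[X] :=
  Polynomial.C (p.coeff 0) * Polynomial.X + Polynomial.C (p.coeff 1)

theorem eval_zero_revLinear (p : F[X]) : (revLinear p).eval 0 = p.coeff 1 := by
  simp [revLinear]

theorem algebraMap_revLinear {p : F[X]} (hp : p.natDegree ≤ 1) :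
    algebraMap F[X] (RatFunc F) (revLinear p) =
      RatFunc.X * invSubst (algebraMap F[X] (RatFunc F) p) := by
  have h := Polynomial.eq_X_add_C_of_natDegree_le_one hp
  conv_rhs => rw [h]
  have hX : (RatFunc.X : RatFunc F) ≠ 0 := RatFunc.X_ne_zero
  simp only [revLinear, map_add, map_mul, RatFunc.algebraMap_C, RatFunc.algebraMap_X, invSubst_C,
    invSubst_X]
  field_simp
  ring

theorem revRat_one_pencilOf {n m : ℕ} (c : F) {g h : ℕ → F[X]}
    (D : ℕ → Matrix (Fin m) (Fin m) F)
    (hg : ∀ k, (g k).natDegree ≤ 1) (hh : ∀ k, (h k).natDegree ≤ 1) :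
    revRat 1 (toRat (pencilOf n c g h D)) =
      toRat (pencilOf n c (fun k => revLinear (g k)) (fun k => revLinear (h k)) D) := by
  have key : ∀ (p : F[X]) (u v : F), p.natDegree ≤ 1 →
      RatFunc.X * invSubst (algebraMap F[X] (RatFunc F) (Polynomial.C u * p * Polynomial.C v)) =
        algebraMap F[X] (RatFunc F) (Polynomial.C u * revLinear p * Polynomial.C v) := by
    intro p u v hp
    simp only [map_mul, RatFunc.algebraMap_C, invSubst_C, algebraMap_revLinear hp]
    ring
  ext i ⟨j, l⟩
  rw [revRat_apply, zpow_one]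
  rcases i with i | ⟨i, k⟩
  · simp only [toRat, pencilOf, topRowOf, Matrix.map_apply, Matrix.fromRows_apply_inl, map_add,
      mul_add, key _ _ _ (hg _)]
    congr 1
    split_ifs
    · exact key _ _ _ (hh _)
    · simp
  · change RatFunc.X * invSubst (toRat (bidiagonalOf n g h ⊗ₖ
        (1 : Matrix (Fin m) (Fin m) F[X])) (i, k) (j, l)) =
      toRat (bidiagonalOf n (fun k => revLinear (g k)) (fun k => revLinear (h k)) ⊗ₖ
        (1 : Matrix (Fin m) (Fin m) F[X])) (i, k) (j, l)
    simp only [toRat_kronecker_one_apply, bidiagonalOf]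
    split_ifs <;> simp [algebraMap_revLinear, hg, hh]

variable {σ β : ℕ → F} {ξ : ℕ → OnePoint F}

theorem eval_zero_revLinear_hFun (k : ℕ) : (revLinear (hFun σ k)).eval 0 = 1 := by
  simp [eval_zero_revLinear, hFun]

open Classical in
/-- The reversal of `g k` has a simple zero at `0` if `ξ k = ∞`, and does not vanish there
otherwise. -/
theorem exists_revLinear_gFun_eq {k : ℕ} (hβ : β k ≠ 0) (hξ : ξ k ≠ ((0 : F) : OnePoint F)) :
    ∃ u, UnitFunAt 0 u ∧ algebraMap F[X] (RatFunc F) (revLinear (gFun β ξ k)) =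
      (if ξ k = OnePoint.infty then RatFunc.X else 1) * u := by
  by_cases h : ξ k = OnePoint.infty
  · refine ⟨RatFunc.C (β k), unitFunAt_C hβ, ?_⟩
    rw [if_pos h, gFun_of_eq_infty h]
    rw [mul_comm]
    simp [revLinear, Polynomial.coeff_C]
  · obtain ⟨x, hx⟩ := OnePoint.ne_infty_iff_exists.mp h
    have hx0 : x ≠ 0 := by
      rintro rfl
      exact hξ hx.symm
    refine ⟨algebraMap F[X] (RatFunc F) (revLinear (gFun β ξ k)), unitFunAt_algebraMap ?_, ?_⟩
    · rw [eval_zero_revLinear, gFun_of_eq_coe hx.symm]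
      simp [Polynomial.coeff_one, hβ, hx0]
    · rw [if_neg h, one_mul]

open Classical in
theorem numInfinitePoles_succ (i : ℕ) :
    (RatFunc.X : RatFunc F) ^ numInfinitePoles (i + 1) ξ =
      RatFunc.X ^ numInfinitePoles i ξ *
        (if ξ (i + 1) = OnePoint.infty then RatFunc.X else 1) := by
  unfold numInfinitePoles
  rw [← Finset.insert_Icc_right_eq_Icc_add_one (by omega), Finset.filter_insert]
  split_ifs
  · rw [Finset.card_insert_of_notMem (by simp), pow_succ]
  · simp

theorem invSubst_bFun_succ_mul {i : ℕ} (hβ : β (i + 1) ≠ 0) :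
    invSubst (bFun σ β ξ (i + 1)) *
        algebraMap F[X] (RatFunc F) (revLinear (gFun β ξ (i + 1))) =
      invSubst (bFun σ β ξ i) * algebraMap F[X] (RatFunc F) (revLinear (hFun σ i)) := by
  rw [algebraMap_revLinear (natDegree_gFun_le _), algebraMap_revLinear (natDegree_hFun_le _)]
  have := congrArg invSubst (bFun_succ_mul (σ := σ) (ξ := ξ) hβ)
  rw [map_mul, map_mul] at this
  linear_combination RatFunc.X * this

/-- At infinity, `b i` has a pole whose order is the number of infinite poles among
`ξ 1, …, ξ i`. -/
theorem unitFunAt_zero_pow_mul_invSubst_bFun {N : ℕ}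
    (hξ : ∀ k, 1 ≤ k → k ≤ N → ξ k ≠ ((0 : F) : OnePoint F)) (hβ : ∀ k, k ≤ N → β k ≠ 0) :
    ∀ i ≤ N, UnitFunAt 0 (RatFunc.X ^ numInfinitePoles i ξ * invSubst (bFun σ β ξ i)) := by
  intro i
  induction i with
  | zero =>
    intro _
    have h0 : numInfinitePoles 0 ξ = 0 := by simp [numInfinitePoles]
    rw [h0, pow_zero, one_mul, bFun_zero, invSubst_C]
    exact unitFunAt_C (inv_ne_zero (hβ 0 (by omega)))
  | succ i ih =>
    intro hi
    obtain ⟨u, hu, hgu⟩ := exists_revLinear_gFun_eq (hβ _ hi) (hξ (i + 1) (by omega) hi)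
    have hh : UnitFunAt 0 (algebraMap F[X] (RatFunc F) (revLinear (hFun σ i))) :=
      unitFunAt_algebraMap (by simp [eval_zero_revLinear_hFun])
    have hrec := invSubst_bFun_succ_mul (σ := σ) (ξ := ξ) (hβ _ hi)
    rw [hgu] at hrec
    have : RatFunc.X ^ numInfinitePoles (i + 1) ξ * invSubst (bFun σ β ξ (i + 1)) =
        RatFunc.X ^ numInfinitePoles i ξ * invSubst (bFun σ β ξ i) *
          algebraMap F[X] (RatFunc F) (revLinear (hFun σ i)) * u⁻¹ := by
      rw [eq_mul_inv_iff_mul_eq₀ hu.ne_zero, numInfinitePoles_succ]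
      linear_combination RatFunc.X ^ numInfinitePoles i ξ * hrec
    rw [this]
    exact ((ih (by omega)).mul hh).mul hu.inv

theorem revRat_QMat {m : ℕ} (N : ℕ) (D : ℕ → Matrix (Fin m) (Fin m) F) (k : ℕ) :
    revRat (k : ℤ) (QMat N σ β ξ D) =
      ∑ i ∈ Finset.range (N + 1),
        (RatFunc.X ^ k * invSubst (bFun σ β ξ i)) • (D i).map RatFunc.C := by
  ext i j
  rw [revRat_apply, zpow_natCast, QMat, Matrix.sum_apply, Matrix.sum_apply, map_sum,
    Finset.mul_sum]
  refine Finset.sum_congr rfl fun l _ => ?_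
  simp only [Matrix.smul_apply, Matrix.map_apply, smul_eq_mul, map_mul, invSubst_C]
  ring

end ReversedPencil

/-! ### Systems with empty state matrix -/

section EmptyState

variable {F : Type*} [Field F]

theorem minimalAt_of_isEmpty {ν ι κ : Type*} [Fintype κ] [Fintype ν] [DecidableEq ν] [IsEmpty ν]
    (P : SystemMatrix F ν ι κ) (a : F) : P.MinimalAt a := by
  refine ⟨le_antisymm (Matrix.rank_le_card_width _) (by simp), rank_of_isEmpty_rows _⟩

theorem transfer_ofEmptyState {ι κ : Type*} (L : Matrix ι κ F[X]) :
    (SystemMatrix.ofEmptyState L).transfer = toRat L := by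
  ext i j
  simp [SystemMatrix.transfer, SystemMatrix.ofEmptyState, Matrix.mul_apply]

variable {ι κ : Type*} [Fintype ι] [Fintype κ]

theorem degree_toMatrix_ofEmptyState (L : Matrix ι κ F[X]) :
    degree (SystemMatrix.ofEmptyState L).toMatrix = degree L := by
  apply le_antisymm
  · refine Finset.sup_le fun i _ => Finset.sup_le fun j _ => ?_
    rcases i with i | i
    · exact i.elim
    rcases j with j | j
    · exact j.elim
    exact le_trans (Finset.le_sup (f := fun j => (L i j).natDegree) (Finset.mem_univ j))
      (Finset.le_sup (f := fun i => Finset.univ.sup fun j => (L i j).natDegree)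
        (Finset.mem_univ i))
  · refine Finset.sup_le fun i _ => Finset.sup_le fun j _ => ?_
    exact le_trans
      (Finset.le_sup (f := fun j =>
        ((SystemMatrix.ofEmptyState L).toMatrix (Sum.inr i) j).natDegree)
        (Finset.mem_univ (Sum.inr j)))
      (Finset.le_sup (f := fun i => Finset.univ.sup fun j =>
        ((SystemMatrix.ofEmptyState L).toMatrix i j).natDegree) (Finset.mem_univ (Sum.inr i)))

theorem isLinear_ofEmptyState {L : Matrix ι κ F[X]} (hL : IsPencil L) :
    (SystemMatrix.ofEmptyState L).IsLinear :=
  ⟨by simp, by rwa [IsPencil, degree_toMatrix_ofEmptyState]⟩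

end EmptyState

end LocalLin

end

/-! ### Linearizations of NLEIGS rational matrices -/

theorem theorem6p1 {F : Type*} [Field F] [IsAlgClosed F] (N m : ℕ) (hN : 1 ≤ N)
    (σ : ℕ → F) (ξ : ℕ → OnePoint F) (β : ℕ → F)
    (hξ : ∀ k, 1 ≤ k → k ≤ N → ξ k ≠ ((0 : F) : OnePoint F))
    (hβ : ∀ k, k ≤ N → β k ≠ 0)
    (D : ℕ → Matrix (Fin m) (Fin m) F) :
    LocalLin.IsBlockFullRankPencilAssociatedIn
        (LocalLin.oneBlockColumn (LocalLin.LMat N σ β ξ D))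
        (LocalLin.QMat N σ β ξ D) (LocalLin.finitePoles N ξ)ᶜ ∧
      LocalLin.IsLinearizationIn
        (LocalLin.SystemMatrix.ofEmptyState (LocalLin.LMat N σ β ξ D))
        (LocalLin.QMat N σ β ξ D) (LocalLin.finitePoles N ξ)ᶜ ∧
      ((N = 1 → LocalLin.degree (LocalLin.LMat N σ β ξ D) = 1) →
        LocalLin.IsLinearizationAtInfinity
          (LocalLin.SystemMatrix.ofEmptyState (LocalLin.LMat N σ β ξ D))
          (LocalLin.QMat N σ β ξ D) (LocalLin.numInfinitePoles N ξ : ℤ)) := by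
  open LocalLin in
  obtain ⟨n, rfl⟩ : ∃ n, N = n + 1 := ⟨N - 1, by omega⟩
  -- `0` is not among the poles.
  have hS : ((finitePoles (n + 1) ξ)ᶜ).Nonempty :=
    ⟨0, fun ⟨k, hk1, hkN, hk⟩ => hξ k hk1 hkN hk⟩
  have hpencil : IsPencil (LMat (n + 1) σ β ξ D) := isPencil_LMat D
  have hrec : ∀ i ≤ n, bFun σ β ξ (i + 1) * algebraMap F[X] (RatFunc F) (gFun β ξ (i + 1)) =
      bFun σ β ξ i * algebraMap F[X] (RatFunc F) (hFun σ i) := fun i hi =>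
    bFun_succ_mul (hβ _ (by omega))
  have hg : ∀ a ∈ (finitePoles (n + 1) ξ)ᶜ, ∀ k, 1 ≤ k → k ≤ n + 1 →
      (gFun β ξ k).eval a ≠ 0 := fun a ha k hk hk' =>
    eval_gFun_ne_zero (hβ k hk') (hξ k hk hk') fun h => ha ⟨k, hk, hk', h⟩
  have hb0 : ∀ a : F, UnitFunAt a (bFun σ β ξ 0) := fun a => by
    rw [bFun_zero]
    exact unitFunAt_C (inv_ne_zero (hβ 0 (by omega)))
  have hb0' : bFun σ β ξ ((0 : Fin (n + 1)) : ℕ) ≠ 0 := (hb0 0).ne_zero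
  have hr : ∀ a ∈ (finitePoles (n + 1) ξ)ᶜ, ∀ j : Fin (n + 1),
      RegularFunAt a (bFun σ β ξ j / bFun σ β ξ ((0 : Fin (n + 1)) : ℕ)) := fun a ha j =>
    regularFunAt_div_first hrec hb0' (fun k hk hk' => hg a ha k hk (by omega)) j (by omega)
  have hd : ∀ a ∈ (finitePoles (n + 1) ξ)ᶜ, UnitFunAt a (RatFunc.C (β (n + 1))⁻¹ *
      algebraMap F[X] (RatFunc F) (gFun β ξ (n + 1)) / bFun σ β ξ ((0 : Fin (n + 1)) : ℕ)) :=
    fun a ha => ((unitFunAt_C (inv_ne_zero (hβ _ le_rfl))).mul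
      (unitFunAt_algebraMap (hg a ha _ (by omega) le_rfl))).div (hb0 a)
  have hB : ∀ a ∈ (finitePoles (n + 1) ξ)ᶜ, ((bidiagonalOf n (gFun β ξ) (hFun σ)).submatrix id
      (Fin.succAbove 0)).det.eval a ≠ 0 := fun a ha => by
    rw [det_bidiagonalOf_zero, Polynomial.eval_prod]
    exact Finset.prod_ne_zero_iff.mpr fun i _ => hg a ha _ (by omega) (by omega)
  refine ⟨?_, ⟨hS, fun a ha => ⟨isLinear_ofEmptyState hpencil, minimalAt_of_isEmpty _ a, ?_⟩⟩,
    fun h1 => ⟨isLinear_ofEmptyState hpencil, minimalAt_of_isEmpty _ 0, ?_⟩⟩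
  · exact isBlockFullRankPencilAssociatedIn_pencilOf 0 _ D hS hpencil hrec hb0' hr hd hB
  · rw [transfer_ofEmptyState]
    exact equivUpToIdentityAt_pencilOf 0 _ D hrec hb0' (hr a ha) (hd a ha) (hB a ha)
  · rw [transfer_ofEmptyState, degree_toMatrix_ofEmptyState]
    -- If `m = 0` the degree may be `0`, but then there are no entries.
    have hrev : revRat (degree (LMat (n + 1) σ β ξ D) : ℤ) (toRat (LMat (n + 1) σ β ξ D)) =
        revRat 1 (toRat (LMat (n + 1) σ β ξ D)) := by
      rcases Nat.eq_zero_or_pos m with rfl | hm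
      · ext i ⟨_, j⟩
        exact j.elim0
      · rcases Nat.eq_zero_or_pos n with rfl | hn
        · rw [h1 rfl, Nat.cast_one]
        · rw [degree_LMat hn hm, Nat.cast_one]
    rw [hrev, LMat_eq_pencilOf, revRat_one_pencilOf _ D natDegree_gFun_le natDegree_hFun_le,
      revRat_QMat]
    obtain ⟨u, hu, hgu⟩ := exists_revLinear_gFun_eq (hβ _ le_rfl) (hξ (n + 1) (by omega) le_rfl)
    have hX : (RatFunc.X : RatFunc F) ≠ 0 := RatFunc.X_ne_zero
    have hbn := unitFunAt_zero_pow_mul_invSubst_bFun (σ := σ) hξ hβ n (by omega)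
    have hrec' : ∀ i ≤ n,
        RatFunc.X ^ numInfinitePoles (n + 1) ξ * invSubst (bFun σ β ξ (i + 1)) *
            algebraMap F[X] (RatFunc F) (revLinear (gFun β ξ (i + 1))) =
          RatFunc.X ^ numInfinitePoles (n + 1) ξ * invSubst (bFun σ β ξ i) *
            algebraMap F[X] (RatFunc F) (revLinear (hFun σ i)) := fun i hi => by
      rw [mul_assoc, mul_assoc, invSubst_bFun_succ_mul (hβ _ (by omega))]
    have hn0 : RatFunc.X ^ numInfinitePoles (n + 1) ξ *
        invSubst (bFun σ β ξ ((Fin.last n : Fin (n + 1)) : ℕ)) ≠ 0 :=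
      mul_ne_zero (pow_ne_zero _ hX) (right_ne_zero_of_mul hbn.ne_zero)
    refine equivUpToIdentityAt_pencilOf (b := fun i =>
      RatFunc.X ^ numInfinitePoles (n + 1) ξ * invSubst (bFun σ β ξ i))
      (Fin.last n) _ D hrec' hn0 (fun j => ?_) ?_ ?_
    · exact regularFunAt_div_last (a := 0) (n := n)
        (b := fun i => RatFunc.X ^ numInfinitePoles (n + 1) ξ * invSubst (bFun σ β ξ i))
        (g := fun k => revLinear (gFun β ξ k)) (h := fun k => revLinear (hFun σ k)) hrec' hn0
        (fun k _ => by simp [eval_zero_revLinear_hFun]) j (by omega)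
    · -- A possible zero of the reversed `g N` at `0` is cancelled by the last factor of
      -- `X ^ i_N`.
      have hx : (RatFunc.X : RatFunc F) ^ numInfinitePoles (n + 1) ξ ≠ 0 := pow_ne_zero _ hX
      rw [numInfinitePoles_succ] at hx
      have heq : RatFunc.C (β (n + 1))⁻¹ *
            algebraMap F[X] (RatFunc F) (revLinear (gFun β ξ (n + 1))) /
          (RatFunc.X ^ numInfinitePoles (n + 1) ξ * invSubst (bFun σ β ξ n)) =
          RatFunc.C (β (n + 1))⁻¹ * u /
            (RatFunc.X ^ numInfinitePoles n ξ * invSubst (bFun σ β ξ n)) := by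
        rw [hgu, numInfinitePoles_succ, div_eq_div_iff
          (mul_ne_zero hx (right_ne_zero_of_mul hbn.ne_zero)) hbn.ne_zero]
        ring
      change UnitFunAt 0 (_ / (_ * invSubst (bFun σ β ξ n)))
      rw [heq]
      exact ((unitFunAt_C (inv_ne_zero (hβ _ le_rfl))).mul hu).div hbn
    · rw [det_bidiagonalOf_last, Polynomial.eval_prod]
      exact Finset.prod_ne_zero_iff.mpr fun i _ => by simp [eval_zero_revLinear_hFun]
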